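/- Let $K$ be a field of characteristic different from $2$. A $K$-variety is a separated scheme of finite type over $K$. Let $K_0(\mathrm{Var}_K)$ be the Grothendieck ring of varieties: the free abelian group on isomorphism classes $[X]$ of $K$-varieties modulo the relations $[X]=[Z]+[X\setminus Z]$ for every closed embedding $Z\hookrightarrow X$, with product induced by $[X]\cdot[Y]=[X\times_K Y]$. Let $\mathbb{L}:=[\mathbb{A}^1]$. For $n\in\mathbb{N}$ and $k\in\mathbb{Z}$ let $\mathrm{Sym}^{n,\le k}$ be the closed subscheme of the affine space of symmetric $n\times n$ matrices defined by the vanishing of all minors of size greater than $k$ (empty for $k<0$), and let $\mathrm{Sym}^{n,k}:=\mathrm{Sym}^{n,\le k}\setminus\mathrm{Sym}^{n,\le k-1}$ be the variety of symmetric $n\times n$ matrices of rank $k$. Then for every $n\in\mathbb{N}$, in $K_0(\mathrm{Var}_K)$: 1. $[\mathrm{Sym}^{n,k}]=0$ for $k>n$ and for $k<0$; 2. $[\mathrm{Sym}^{n,0}]=1$; 3. for $0<k\le n$, the rational function $$P_{n,k}(x)=\Big(\prod_{i=1}^{\lfloor k/2\rfloor}\frac{x^{2i}}{x^{2i}-1}\Big)\prod_{i=0}^{k-1}\big(x^{n-i}-1\big)$$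 is a polynomial with integer coefficients, and $[\mathrm{Sym}^{n,k}]=P_{n,k}(\mathbb{L})$. -/

import Mathlib

open CategoryTheory MonoidalCategory AlgebraicGeometry

universe u

namespace KZero

/-- A `K`-variety is a separated scheme of finite type over `K`
(neither irreducible nor reduced in general). -/
def IsVariety (K : Type u) [Field K] : ObjectProperty (Over (Spec (.of K))) := fun X =>
  IsSeparated X.hom ∧ LocallyOfFiniteType X.hom ∧ QuasiCompact X.hom

instance isMonoidal_isVariety (K : Type u) [Field K] : (IsVariety K).IsMonoidal where
  prop_unit := by
    exact ⟨inferInstanceAs (IsSeparated (𝟙 (Spec (.of K)))),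
      inferInstanceAs (LocallyOfFiniteType (𝟙 (Spec (.of K)))),
      inferInstanceAs (QuasiCompact (𝟙 (Spec (.of K))))⟩
  prop_tensor X Y hX hY := by
    obtain ⟨h1, h2, h3⟩ := hX
    obtain ⟨h4, h5, h6⟩ := hY
    refine ⟨?_, ?_, ?_⟩ <;> rw [Over.tensorObj_hom] <;> infer_instance

/-- The category of varieties over `K`. Its tensor product is the fibre product over `K`. -/
abbrev Var (K : Type u) [Field K] : Type (u + 1) := (IsVariety K).FullSubcategory

/-- The ring `ℤ[iso classes of K-varieties]`: the free abelian group on isomorphism classes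
of varieties, with the product induced by `X ×_K Y`. -/
abbrev FreeVar (K : Type u) [Field K] : Type (u + 1) := FreeAbelianGroup (Skeleton (Var K))

/-- The generator of `FreeVar K` given by a variety. -/
noncomputable def freeCls {K : Type u} [Field K] (X : Var K) : FreeVar K :=
  FreeAbelianGroup.of (toSkeleton X)

/-- The cut and paste relations `[X] - [Z] - [X - Z]`, one for each closed embedding
`i : Z ⟶ X` of varieties; `j : U ⟶ X` is the open complement of `i`. -/
def scissors (K : Type u) [Field K] : Set (FreeVar K) :=
  {r | ∃ (X Z U : Var K) (i : Z ⟶ X) (j : U ⟶ X),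
    IsClosedImmersion i.hom.left ∧ IsOpenImmersion j.hom.left ∧
    Set.range j.hom.left = (Set.range i.hom.left)ᶜ ∧
    r = freeCls X - freeCls Z - freeCls U}

/-- The Grothendieck ring of varieties `K₀(Var_K)`. The relations are stable under products
with a variety, so the ideal they generate is the subgroup they generate. -/
abbrev K0 (K : Type u) [Field K] : Type (u + 1) := FreeVar K ⧸ Ideal.span (scissors K)

/-- The class `[X]` of a variety in `K₀(Var_K)`. -/
noncomputable def cls {K : Type u} [Field K] (X : Var K) : K0 K :=
  Ideal.Quotient.mk (Ideal.span (scissors K)) (freeCls X)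

/-- The affine line over `K`. -/
noncomputable def affineLine (K : Type u) [Field K] : Var K :=
  ⟨Over.mk (𝔸(PUnit.{u + 1}; Spec (.of K)) ↘ Spec (.of K)), by
    refine ⟨?_, ?_, ?_⟩ <;>
    · dsimp only [Over.mk_hom]
      infer_instance⟩

/-- The Lefschetz class `𝕃 = [𝔸¹]`. -/
noncomputable def lefschetz (K : Type u) [Field K] : K0 K := cls (affineLine K)

/-- Coordinate ring of the affine space of symmetric `n × n` matrices: one variable for each
unordered pair of indices. -/
abbrev SymRing (K : Type u) [Field K] (n : ℕ) : Type u := MvPolynomial (Sym2 (Fin n)) K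

/-- The generic symmetric `n × n` matrix. -/
noncomputable def genericSym (K : Type u) [Field K] (n : ℕ) :
    Matrix (Fin n) (Fin n) (SymRing K n) :=
  Matrix.of fun i j => MvPolynomial.X s(i, j)

/-- The ideal generated by all minors of size greater than `k` of the generic symmetric matrix.
For `k < 0` it contains the `0 × 0` minor, which is `1`. Minors with repeated rows or
columns are `0`. -/
noncomputable def minorIdeal (K : Type u) [Field K] (n : ℕ) (k : ℤ) : Ideal (SymRing K n) :=
  Ideal.span {p | ∃ (r : ℕ) (f g : Fin r → Fin n), k < r ∧
    p = ((genericSym K n).submatrix f g).det}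

/-- The closed subscheme of symmetric `n × n` matrices of rank at most `k`. -/
noncomputable abbrev symLE (K : Type u) [Field K] (n : ℕ) (k : ℤ) : Scheme.{u} :=
  Spec (.of (SymRing K n ⧸ minorIdeal K n k))

/-- The open subset of `symLE K n k` where the rank is exactly `k`: the complement of the
locus where all minors of size greater than `k - 1` vanish. -/
noncomputable def symOpen (K : Type u) [Field K] (n : ℕ) (k : ℤ) : (symLE K n k).Opens where
  carrier := (PrimeSpectrum.zeroLocus
    (Ideal.map (Ideal.Quotient.mk (minorIdeal K n k)) (minorIdeal K n (k - 1)) :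
      Set (SymRing K n ⧸ minorIdeal K n k)))ᶜ
  is_open' := (PrimeSpectrum.isClosed_zeroLocus _).isOpen_compl

/-- The structure morphism of the scheme of symmetric `n × n` matrices of rank `k`. -/
noncomputable def symHom (K : Type u) [Field K] (n : ℕ) (k : ℤ) :
    (symOpen K n k : Scheme.{u}) ⟶ Spec (.of K) :=
  (symOpen K n k).ι ≫
    Spec.map (CommRingCat.ofHom (algebraMap K (SymRing K n ⧸ minorIdeal K n k)))

/-- The variety `Sym^{n,k}` of symmetric `n × n` matrices of rank `k` over `K`. -/
noncomputable def symVar (K : Type u) [Field K] (n : ℕ) (k : ℤ) : Var K :=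
  ⟨Over.mk (symHom K n k), by
    have h1 : LocallyOfFiniteType (Spec.map (CommRingCat.ofHom
        (algebraMap K (SymRing K n ⧸ minorIdeal K n k)))) := by
      rw [HasRingHomProperty.Spec_iff (P := @LocallyOfFiniteType)]
      exact RingHom.finiteType_algebraMap.mpr inferInstance
    have h2 : IsNoetherianRing (CommRingCat.of (SymRing K n ⧸ minorIdeal K n k)) :=
      inferInstanceAs (IsNoetherianRing (SymRing K n ⧸ minorIdeal K n k))
    refine ⟨?_, ?_, ?_⟩ <;>
    · dsimp only [Over.mk_hom, symHom]
      infer_instance⟩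

end KZero

/-! ### Classes of affine varieties in the Grothendieck ring -/

namespace KZero

variable {K : Type u} [Field K]

/-! The rank loci are computed by Gaussian elimination on the first row. Let `s(n, k)` be the class
of the symmetric `n × n` matrices of rank at most `k`, and stratify those of size `n + 1` by the
first row `b`. If `b 0` is a unit, the Schur complement of this entry is an arbitrary symmetric `n ×
n` matrix of rank at most `k - 1`. If `b 0 = 0` and some other `b j` is a unit, the block on the
indices `0, j` has determinant `-(b j)²`; it is a pivot of rank `2`, the rest of row `j` is free,
and the Schur complement has size `n - 1` and rank at most `k - 2`. If `b = 0`, a matrix of size `n`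
and rank at most `k` remains. Hence `s(n+1, k) = s(n, k) + (𝕃-1) 𝕃^n s(n, k-1) + (𝕃^n-1) 𝕃^n s(n-1,
k-2)`, which is `symCls_succ_eq`. Differences in `k` give the same recursion for rank exactly `k`,
and `rankPoly_mul` checks that the closed formula satisfies it.

All strata are affine, so the work is done with quotients of polynomial rings. Classes ignore
nilpotents, so an ideal of minors may be replaced by any ideal with the same field-valued points
(`acls_quotient_congr`). There minors express rank, and elimination becomes an identity of ranks
over fields. The pivots are treated together in `acls_minors_fromBlocks`. -/

theorem cls_congr {X Y : Var K} (e : X ≅ Y) : cls X = cls Y := by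
  unfold cls freeCls
  have h : toSkeleton X = toSkeleton Y := Quotient.sound ⟨e⟩
  rw [h]

theorem cls_mk_congr {X Y : Scheme.{u}} {f : X ⟶ Spec (.of K)} {g : Y ⟶ Spec (.of K)}
    (hf : IsVariety K (Over.mk f)) (hg : IsVariety K (Over.mk g)) (e : X ≅ Y)
    (h : e.hom ≫ g = f) : cls (⟨Over.mk f, hf⟩ : Var K) = cls ⟨Over.mk g, hg⟩ :=
  cls_congr ((IsVariety K).isoMk (Over.isoMk e h))

theorem cls_scissors {X Z U : Var K} (i : Z ⟶ X) (j : U ⟶ X)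
    (hi : IsClosedImmersion i.hom.left) (hj : IsOpenImmersion j.hom.left)
    (h : Set.range j.hom.left = (Set.range i.hom.left)ᶜ) : cls X = cls Z + cls U := by
  have hmem : freeCls X - freeCls Z - freeCls U ∈ scissors K :=
    ⟨X, Z, U, i, j, hi, hj, h, rfl⟩
  have := Ideal.Quotient.eq_zero_iff_mem.mpr (Ideal.subset_span hmem)
  rw [map_sub, map_sub, sub_sub, sub_eq_zero] at this
  exact this

theorem cls_mk_scissors {X Z U : Scheme.{u}} {f : X ⟶ Spec (.of K)} {g : Z ⟶ Spec (.of K)}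
    {h : U ⟶ Spec (.of K)} (hf : IsVariety K (Over.mk f)) (hg : IsVariety K (Over.mk g))
    (hh : IsVariety K (Over.mk h)) (i : Z ⟶ X) (j : U ⟶ X) (hi : i ≫ f = g) (hj : j ≫ f = h)
    [IsClosedImmersion i] [IsOpenImmersion j] (hr : Set.range j = (Set.range i)ᶜ) :
    cls (⟨Over.mk f, hf⟩ : Var K) = cls ⟨Over.mk g, hg⟩ + cls ⟨Over.mk h, hh⟩ :=
  cls_scissors (ObjectProperty.homMk (Over.homMk i hi)) (ObjectProperty.homMk (Over.homMk j hj))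
    ‹_› ‹_› hr

theorem cls_tensor (X Y : Var K) : cls (X ⊗ Y) = cls X * cls Y := by
  unfold cls freeCls
  rw [← map_mul, Skeleton.toSkeleton_tensorObj, FreeAbelianGroup.of_mul_of]

theorem cls_unit : cls (𝟙_ (Var K)) = 1 := by
  unfold cls freeCls
  rw [← Skeleton.one_eq, ← FreeAbelianGroup.one_def, map_one]

theorem isVariety_specMap (R : Type u) [CommRing R] [Algebra K R] [Algebra.FiniteType K R] :
    IsVariety K (Over.mk (Spec.map (CommRingCat.ofHom (algebraMap K R)))) := by
  have h1 : LocallyOfFiniteType (Spec.map (CommRingCat.ofHom (algebraMap K R))) := by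
    rw [HasRingHomProperty.Spec_iff (P := @LocallyOfFiniteType)]
    exact RingHom.finiteType_algebraMap.mpr inferInstance
  have h2 : QuasiCompact (Spec.map (CommRingCat.ofHom (algebraMap K R))) :=
    quasiCompact_of_compactSpace _
  refine ⟨?_, h1, h2⟩
  dsimp only [Over.mk_hom]
  infer_instance

variable (K) in
/-- The class of the spectrum of a finitely generated `K`-algebra. -/
noncomputable def acls (R : Type u) [CommRing R] [Algebra K R] [Algebra.FiniteType K R] : K0 K :=
  cls ⟨Over.mk (Spec.map (CommRingCat.ofHom (algebraMap K R))), isVariety_specMap R⟩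

theorem specMap_comp_algebraMap {R S : Type u} [CommRing R] [CommRing S]
    [Algebra K R] [Algebra K S] (f : R →ₐ[K] S) :
    Spec.map (CommRingCat.ofHom f.toRingHom) ≫ Spec.map (CommRingCat.ofHom (algebraMap K R)) =
      Spec.map (CommRingCat.ofHom (algebraMap K S)) := by
  rw [← Spec.map_comp, ← CommRingCat.ofHom_comp]
  congr 2
  exact f.comp_algebraMap

theorem range_specMap_of_surjective {R S : Type u} [CommRing R] [CommRing S]
    (p : R →+* S) (hp : Function.Surjective p) :
    Set.range (Spec.map (CommRingCat.ofHom p)) = PrimeSpectrum.zeroLocus (RingHom.ker p) :=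
  range_comap_of_surjective _ _ hp

variable {R S T : Type u} [CommRing R] [CommRing S] [CommRing T] [Algebra K R] [Algebra K S]
  [Algebra K T] [Algebra.FiniteType K R] [Algebra.FiniteType K S] [Algebra.FiniteType K T]

theorem acls_congr (e : R ≃ₐ[K] S) : acls K R = acls K S :=
  cls_mk_congr _ _ (Scheme.Spec.mapIso e.toRingEquiv.toCommRingCatIso.symm.op)
    (specMap_comp_algebraMap e.symm.toAlgHom)

/-- The scissors relation only compares underlying sets, so it is enough that the kernel and `f` cut
out the same closed set; the complement is the basic open set of `f`. -/
theorem acls_split [Algebra R T] [IsScalarTower K R T] (p : R →ₐ[K] S) (f : R)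
    [IsLocalization.Away f T] (hp : Function.Surjective p)
    (hk : (RingHom.ker p).radical = (Ideal.span {f}).radical) :
    acls K R = acls K S + acls K T := by
  have h1 : IsClosedImmersion (Spec.map (CommRingCat.ofHom p.toRingHom)) :=
    IsClosedImmersion.spec_of_surjective _ hp
  have h2 : IsOpenImmersion (Spec.map (CommRingCat.ofHom (algebraMap R T))) :=
    IsOpenImmersion.of_isLocalization f
  refine cls_mk_scissors _ _ _ (Spec.map (CommRingCat.ofHom p.toRingHom))
    (Spec.map (CommRingCat.ofHom (algebraMap R T))) (specMap_comp_algebraMap p)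
    (specMap_comp_algebraMap (IsScalarTower.toAlgHom K R T)) ?_
  rw [range_specMap_of_surjective _ hp, ← PrimeSpectrum.zeroLocus_radical]
  refine (PrimeSpectrum.localization_away_comap_range T f).trans ?_
  rw [show (RingHom.ker p.toRingHom).radical = (Ideal.span {f}).radical from hk,
    PrimeSpectrum.zeroLocus_radical, PrimeSpectrum.zeroLocus_span]
  exact PrimeSpectrum.basicOpen_eq_zeroLocus_compl f

/-- Cutting the empty scheme into two copies of itself gives `[R] = [R] + [R]`. -/
theorem acls_of_subsingleton [Subsingleton R] : acls K R = 0 := by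
  have : IsLocalization.Away (0 : R) R := IsLocalization.away_of_isUnit_of_bijective R
    (by simp [Subsingleton.elim _ (1 : R)]) Function.bijective_id
  have h := acls_split (K := K) (R := R) (S := R) (T := R) (AlgHom.id K R) 0
    Function.surjective_id (by
      congr 1
      ext x
      simp [Subsingleton.elim x 0])
  simpa using h

theorem acls_of_nil (p : R →ₐ[K] S) (hp : Function.Surjective p)
    (hk : ∀ x, p x = 0 → IsNilpotent x) : acls K R = acls K S := by
  have h1 : Subsingleton (Localization.Away (0 : R)) :=
    IsLocalization.subsingleton (M := Submonoid.powers (0 : R)) ⟨1, by simp⟩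
  have : Algebra.FiniteType K (Localization.Away (0 : R)) :=
    Algebra.FiniteType.of_surjective (Algebra.ofId K _) (fun x => ⟨0, Subsingleton.elim _ _⟩)
  rw [acls_split (T := Localization.Away (0 : R)) p 0 hp,
    acls_of_subsingleton (R := Localization.Away (0 : R)), add_zero]
  refine le_antisymm ?_ ?_
  · rw [Ideal.radical_le_radical_iff]
    intro x hx
    obtain ⟨n, hn⟩ := hk x hx
    exact ⟨n, by simp [hn]⟩
  · exact Ideal.radical_mono (by simp)

theorem acls_self : acls K K = 1 := by
  rw [← cls_unit]
  exact cls_mk_congr (g := 𝟙 (Spec (.of K))) _ (IsVariety K).prop_unit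
    (Iso.refl _) (Spec.map_id _).symm

open TensorProduct

instance finiteType_tensorProduct : Algebra.FiniteType K (R ⊗[K] S) :=
  Algebra.FiniteType.trans (S := R) inferInstance inferInstance

theorem acls_tensor : acls K (R ⊗[K] S) = acls K R * acls K S := by
  unfold acls
  rw [← cls_tensor]
  symm
  exact cls_mk_congr ((IsVariety K).prop_tensor (isVariety_specMap R)
    (isVariety_specMap S)) _ (pullbackSpecIso K R S) (pullbackSpecIso_hom_base K R S)

theorem lefschetz_eq : lefschetz K = acls K (MvPolynomial PUnit.{u+1} K) := by
  refine cls_mk_congr _ _ (AffineSpace.SpecIso PUnit (.of K)) ?_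
  rw [← Iso.eq_inv_comp]
  exact (AffineSpace.SpecIso_inv_over (.of K)).symm

variable (K) in
/-- The class of the variety of symmetric `n × n` matrices of rank at most `k`. -/
noncomputable def symCls (n : ℕ) (k : ℤ) : K0 K := acls K (SymRing K n ⧸ minorIdeal K n k)

theorem minorIdeal_mono (n : ℕ) {k l : ℤ} (h : l ≤ k) : minorIdeal K n k ≤ minorIdeal K n l := by
  refine Ideal.span_mono ?_
  rintro p ⟨r, f, g, hr, rfl⟩
  exact ⟨r, f, g, by omega, rfl⟩

/-- The locus of exact rank `k` need not be affine; this writes its class through two affine ones.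
-/
theorem cls_symVar (n : ℕ) (k : ℤ) :
    cls (symVar K n k) = symCls K n k - symCls K n (k - 1) := by
  have hle : minorIdeal K n k ≤ minorIdeal K n (k - 1) := minorIdeal_mono n (by omega)
  have hs := Ideal.Quotient.factor_surjective hle
  have h1 : IsClosedImmersion (Spec.map (CommRingCat.ofHom (Ideal.Quotient.factor hle))) :=
    IsClosedImmersion.spec_of_surjective _ hs
  rw [eq_sub_iff_add_eq']
  symm
  refine cls_mk_scissors _ _ (symVar K n k).property
    (Spec.map (CommRingCat.ofHom (Ideal.Quotient.factor hle)))
    (symOpen K n k).ι (specMap_comp_algebraMap (Ideal.Quotient.factorₐ K hle)) rfl ?_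
  rw [range_specMap_of_surjective _ hs, Ideal.Quotient.factor_ker hle]
  exact Scheme.Opens.range_ι _

end KZero

/-! ### Rank over a field: block elimination and minors -/

section MatrixRank

open Matrix

variable {F m n : Type*} [Field F] [Fintype m] [Fintype n]

/-- Invertible row and column operations make both blocks diagonal, and the rank of a diagonal
matrix counts its nonzero entries. -/
theorem Matrix.rank_fromBlocks_zero_of_isUnit [DecidableEq m] [DecidableEq n] (A : Matrix m m F)
    (D : Matrix n n F) (hA : IsUnit A.det) :
    (fromBlocks A 0 0 D).rank = Fintype.card m + D.rank := by
  classical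
  obtain ⟨V, U, e, hV, hU, h⟩ := D.exists_rank_normal_form
  rw [isUnit_iff_isUnit_det] at hV hU
  set w : n → F := Sum.elim 1 0 ∘ e with hw
  have hN : V * D * U = diagonal w := by
    rw [h, ← diagonal_one, ← diagonal_zero, fromBlocks_diagonal]
    rw [submatrix_diagonal_equiv]
    rfl
  have hD : D.rank = Fintype.card {i // w i ≠ 0} := by
    rw [← rank_diagonal, ← hN, rank_mul_eq_left_of_isUnit_det _ _ hU,
      rank_mul_eq_right_of_isUnit_det _ _ hV]
  have hE : fromBlocks A⁻¹ 0 0 V * fromBlocks A 0 0 D * fromBlocks 1 0 0 U =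
      diagonal (Sum.elim 1 w) := by
    rw [fromBlocks_multiply, fromBlocks_multiply, ← fromBlocks_diagonal, ← hN]
    simp [nonsing_inv_mul _ hA]
  have h1 : IsUnit (fromBlocks A⁻¹ 0 0 V).det := by
    rw [det_fromBlocks_zero₂₁]
    exact (isUnit_nonsing_inv_det _ hA).mul hV
  have h2 : IsUnit (fromBlocks (1 : Matrix m m F) 0 0 U).det := by
    rw [det_fromBlocks_zero₂₁, det_one, one_mul]
    exact hU
  rw [hD, ← rank_mul_eq_right_of_isUnit_det _ _ h1, ← rank_mul_eq_left_of_isUnit_det _ _ h2, hE,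
    rank_diagonal, Fintype.card_congr (Equiv.subtypeSum), Fintype.card_sum]
  congr 1
  simp

theorem Matrix.rank_fromBlocks_of_invertible₁₁ [DecidableEq m] [DecidableEq n] (A : Matrix m m F)
    (B : Matrix m n F) (C : Matrix n m F) (D : Matrix n n F) [Invertible A] :
    (fromBlocks A B C D).rank = Fintype.card m + (D - C * ⅟A * B).rank := by
  rw [fromBlocks_eq_of_invertible₁₁, rank_mul_eq_left_of_isUnit_det,
    rank_mul_eq_right_of_isUnit_det,
    rank_fromBlocks_zero_of_isUnit _ _ (isUnit_det_of_invertible A)]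
  · simp
  · simp

theorem Matrix.exists_linearIndependent_rows (A : Matrix m n F) {r : ℕ}
    (hr : A.rank = r) : ∃ f : Fin r → m, LinearIndependent F (A.submatrix f id).row := by
  obtain ⟨κ, a, ha, hspan, hli⟩ := exists_linearIndependent' F A.row
  have : Fintype κ := Fintype.ofInjective a ha
  have hc : Fintype.card κ = r := by
    rw [← hr, rank_eq_finrank_span_row, ← hspan]
    exact linearIndependent_iff_card_eq_finrank_span.mp hli
  let e : Fin r ≃ κ := (Fintype.equivFinOfCardEq hc).symm
  exact ⟨a ∘ e, hli.comp e e.injective⟩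

/-- Choose a basis of the row space among the rows, then a basis of the column space among the
columns of what is left. -/
theorem Matrix.exists_submatrix_det_ne_zero (A : Matrix m n F) :
    ∃ (f : Fin A.rank → m) (g : Fin A.rank → n), (A.submatrix f g).det ≠ 0 := by
  obtain ⟨f, hf⟩ := A.exists_linearIndependent_rows rfl
  have hr : (A.submatrix f id)ᵀ.rank = A.rank := by
    rw [rank_transpose, hf.rank_matrix, Fintype.card_fin]
  obtain ⟨g, hg⟩ := exists_linearIndependent_rows _ hr
  refine ⟨f, g, ?_⟩
  have h := (isUnit_iff_isUnit_det _).mp (linearIndependent_rows_iff_isUnit.mp hg)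
  rw [← det_transpose]
  exact h.ne_zero

theorem Matrix.minors_eq_zero_iff (A : Matrix m n F) (k : ℤ) :
    (∀ (r : ℕ) (f : Fin r → m) (g : Fin r → n), k < r → (A.submatrix f g).det = 0) ↔
      (A.rank : ℤ) ≤ k := by
  constructor
  · intro h
    by_contra! hk
    obtain ⟨f, g, hfg⟩ := A.exists_submatrix_det_ne_zero
    exact hfg (h _ f g hk)
  · intro hk r f g hr
    by_contra h
    have h1 := rank_of_det_ne_zero h
    have h2 := A.rank_submatrix_le f g
    simp at h1
    omega

theorem Matrix.rank_fromBlocks_zero₁₁ [DecidableEq m] [DecidableEq n] (D : Matrix n n F) :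
    (fromBlocks (0 : Matrix m m F) 0 0 D).rank = D.rank := by
  refine le_antisymm ?_ ?_
  · have h : fromBlocks (0 : Matrix m m F) 0 0 D =
        fromRows (0 : Matrix m n F) 1 * (D * fromCols (0 : Matrix n m F) 1) := by
      rw [mul_fromCols, fromRows_mul]
      ext (i | i) (j | j) <;> simp
    rw [h]
    exact (rank_mul_le_right _ _).trans (rank_mul_le_left _ _)
  · exact (fromBlocks (0 : Matrix m m F) 0 0 D).rank_submatrix_le Sum.inr Sum.inr

end MatrixRank

/-! ### Ideals of minors and classes of quotient rings -/

namespace KZero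

section Minors

variable {R S : Type*} [CommRing R] [CommRing S] {n : Type*}

/-- The ideal generated by the minors of size greater than `k` of a square matrix. -/
def minors (k : ℤ) (A : Matrix n n R) : Ideal R :=
  Ideal.span {p | ∃ (r : ℕ) (f g : Fin r → n), k < r ∧ p = (A.submatrix f g).det}

theorem minors_le_iff (k : ℤ) (A : Matrix n n R) (I : Ideal R) : minors k A ≤ I ↔
    ∀ (r : ℕ) (f g : Fin r → n), k < r → (A.submatrix f g).det ∈ I := by
  rw [minors, Ideal.span_le]
  constructor
  · intro h r f g hr
    exact h ⟨r, f, g, hr, rfl⟩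
  · rintro h _ ⟨r, f, g, hr, rfl⟩
    exact h r f g hr

theorem map_det_submatrix (φ : R →+* S) (A : Matrix n n R) {r : ℕ} (f g : Fin r → n) :
    ((A.map φ).submatrix f g).det = φ (A.submatrix f g).det := by
  rw [RingHom.map_det]
  rfl

theorem map_minors (φ : R →+* S) (k : ℤ) (A : Matrix n n R) :
    (minors k A).map φ = minors k (A.map φ) := by
  rw [minors, minors, Ideal.map_span]
  congr 1
  ext p
  constructor
  · rintro ⟨_, ⟨r, f, g, hr, rfl⟩, rfl⟩
    exact ⟨r, f, g, hr, (map_det_submatrix φ A f g).symm⟩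
  · rintro ⟨r, f, g, hr, rfl⟩
    exact ⟨_, ⟨r, f, g, hr, rfl⟩, (map_det_submatrix φ A f g).symm⟩

theorem minors_le_ker_iff [Fintype n] {F : Type*} [Field F] (φ : R →+* F) (k : ℤ)
    (A : Matrix n n R) : minors k A ≤ RingHom.ker φ ↔ ((A.map φ).rank : ℤ) ≤ k := by
  rw [minors_le_iff, ← Matrix.minors_eq_zero_iff]
  simp only [RingHom.mem_ker, map_det_submatrix]

end Minors

variable {K : Type u} [Field K] {R S T : Type u} [CommRing R] [CommRing S] [CommRing T]
  [Algebra K R] [Algebra K S] [Algebra K T] [Algebra.FiniteType K R] [Algebra.FiniteType K S]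
  [Algebra.FiniteType K T]

theorem acls_quotient_radical (I : Ideal R) : acls K (R ⧸ I) = acls K (R ⧸ I.radical) := by
  refine acls_of_nil (Ideal.Quotient.factorₐ K I.le_radical)
    (Ideal.Quotient.factor_surjective I.le_radical) fun x hx => ?_
  obtain ⟨x, rfl⟩ := Ideal.Quotient.mk_surjective x
  obtain ⟨n, hn⟩ := Ideal.Quotient.eq_zero_iff_mem.mp hx
  exact ⟨n, by rw [← map_pow]; exact Ideal.Quotient.eq_zero_iff_mem.mpr hn⟩

/-- Every prime is the kernel of the map to its residue field, so both ideals lie in the same primes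
and have the same radical. -/
theorem acls_quotient_congr {I J : Ideal R}
    (h : ∀ (F : Type u) [Field F] (φ : R →+* F), I ≤ RingHom.ker φ ↔ J ≤ RingHom.ker φ) :
    acls K (R ⧸ I) = acls K (R ⧸ J) := by
  have key : ∀ P : Ideal R, P.IsPrime → (I ≤ P ↔ J ≤ P) := by
    intro P hP
    have := h (FractionRing (R ⧸ P)) ((algebraMap (R ⧸ P) _).comp (Ideal.Quotient.mk P))
    rwa [RingHom.ker_comp_of_injective _ (IsFractionRing.injective _ _), Ideal.mk_ker] at this
  have : I.radical = J.radical := by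
    rw [Ideal.radical_eq_sInf, Ideal.radical_eq_sInf]
    congr 1
    ext P
    exact ⟨fun hP => ⟨(key P hP.2).mp hP.1, hP.2⟩, fun hP => ⟨(key P hP.2).mpr hP.1, hP.2⟩⟩
  rw [acls_quotient_radical I, acls_quotient_radical J, this]

theorem acls_quotient_map (e : R ≃ₐ[K] S) (I : Ideal R) :
    acls K (R ⧸ I) = acls K (S ⧸ I.map (e : R →+* S)) :=
  acls_congr (Ideal.quotientEquivAlg I _ e rfl)

theorem acls_quotient_split [Algebra R T] [IsScalarTower K R T] (p : R →ₐ[K] S) (f : R)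
    [IsLocalization.Away f T] (hp : Function.Surjective p) (hk : RingHom.ker p = Ideal.span {f})
    (I : Ideal R) : acls K (R ⧸ I) =
      acls K (S ⧸ I.map (p : R →+* S)) + acls K (T ⧸ I.map (algebraMap R T)) := by
  have h1 : IsLocalization.Away (Ideal.Quotient.mk I f) (T ⧸ I.map (algebraMap R T)) := by
    have : IsLocalization (Algebra.algebraMapSubmonoid (R ⧸ I) (Submonoid.powers f))
      (T ⧸ I.map (algebraMap R T)) := inferInstance
    rwa [Algebra.algebraMapSubmonoid, Submonoid.map_powers] at this
  have h2 : IsScalarTower K (R ⧸ I) (T ⧸ I.map (algebraMap R T)) := by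
    refine IsScalarTower.of_algebraMap_eq fun x => ?_
    exact congrArg _ (IsScalarTower.algebraMap_apply K R T x)
  refine acls_split (Ideal.quotientMapₐ (I.map (p : R →+* S)) p Ideal.le_comap_map)
    (Ideal.Quotient.mk I f) ?_ ?_
  · exact Ideal.quotientMap_surjective (H := Ideal.le_comap_map) hp
  · congr 1
    refine le_antisymm (fun x hx => ?_) ?_
    · obtain ⟨x, rfl⟩ := Ideal.Quotient.mk_surjective x
      have hx' : p x ∈ I.map (p : R →+* S) := Ideal.Quotient.eq_zero_iff_mem.mp hx
      obtain ⟨y, hy, hxy⟩ := (Ideal.mem_map_iff_of_surjective (p : R →+* S) hp).mp hx'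
      -- Modulo `I`, the element `x` equals `x - y`, which is a multiple of `f`.
      have hk' : x - y ∈ RingHom.ker p := by
        rw [RingHom.mem_ker, map_sub, sub_eq_zero]
        exact hxy.symm
      rw [hk, Ideal.mem_span_singleton] at hk'
      rw [← sub_zero (Ideal.Quotient.mk I x), ← Ideal.Quotient.eq_zero_iff_mem.mpr hy, ← map_sub,
        Ideal.mem_span_singleton]
      exact map_dvd _ hk'
    · rw [Ideal.span_singleton_le_iff_mem]
      have hf : p f = 0 := by
        rw [← RingHom.mem_ker, hk]
        exact Ideal.mem_span_singleton_self f
      change Ideal.Quotient.mk _ (p f) = 0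
      rw [hf, map_zero]

open TensorProduct in
theorem acls_mvPolynomial_quotient {σ : Type} [Finite σ] (I : Ideal (MvPolynomial σ K)) :
    acls K (MvPolynomial σ R ⧸ I.map (MvPolynomial.map (algebraMap K R))) =
      acls K R * acls K (MvPolynomial σ K ⧸ I) := by
  rw [← acls_tensor]
  let e : MvPolynomial σ R ≃ₐ[K] R ⊗[K] MvPolynomial σ K :=
    (MvPolynomial.algebraTensorAlgEquiv (σ := σ) K R).symm.restrictScalars K
  have h : (I.map (MvPolynomial.map (algebraMap K R))).map
      (e : MvPolynomial σ R →+* R ⊗[K] MvPolynomial σ K) =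
      I.map (Algebra.TensorProduct.includeRight (A := R) (R := K)) := by
    rw [Ideal.map_map]
    change I.map _ = I.map (Algebra.TensorProduct.includeRight (A := R) (R := K) :
      MvPolynomial σ K →ₐ[K] R ⊗[K] MvPolynomial σ K).toRingHom
    congr 1
    exact RingHom.ext fun x => MvPolynomial.algebraTensorAlgEquiv_symm_map K R x
  have e1 := Ideal.quotientEquivAlg (I.map (MvPolynomial.map (algebraMap K R))) _
    e h.symm
  have e2 := Algebra.TensorProduct.tensorQuotientEquiv (R := K) K (MvPolynomial σ K) R I
  exact acls_congr (e1.trans e2.symm)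

theorem acls_mvPolynomial_pUnit :
    acls K (MvPolynomial PUnit.{u + 1} R) = acls K R * lefschetz K := by
  rw [lefschetz_eq, ← acls_tensor]
  exact acls_congr ((MvPolynomial.algebraTensorAlgEquiv K R).symm.restrictScalars K)

theorem acls_mvPolynomial_fin (m : ℕ) :
    acls K (MvPolynomial (Fin m) R) = acls K R * lefschetz K ^ m := by
  induction m with
  | zero =>
    rw [pow_zero, mul_one]
    exact acls_congr ((MvPolynomial.isEmptyAlgEquiv R (Fin 0)).restrictScalars K)
  | succ m ih =>
    rw [pow_succ, ← mul_assoc, ← ih, ← acls_mvPolynomial_pUnit]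
    exact acls_congr (((MvPolynomial.finSuccEquiv R m).restrictScalars K).trans
      ((MvPolynomial.uniqueAlgEquiv _ PUnit).symm.restrictScalars K))

end KZero

/-! ### The generic symmetric matrix and its bordered form -/

namespace KZero

section Border

variable {R : Type*} {n : ℕ}

/-- The matrix with row and column `j` given by `b`, and the other entries given by `D`. -/
def border (j : Fin (n + 1)) (b : Fin (n + 1) → R) (D : Matrix (Fin n) (Fin n) R) :
    Matrix (Fin (n + 1)) (Fin (n + 1)) R :=
  Matrix.of (j.insertNth b fun p => j.insertNth (b (j.succAbove p)) fun q => D p q)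

variable (j : Fin (n + 1)) (b : Fin (n + 1) → R) (D : Matrix (Fin n) (Fin n) R)

@[simp]
theorem border_same (l : Fin (n + 1)) : border j b D j l = b l := by
  simp [border]

@[simp]
theorem border_succAbove_same (p : Fin n) :
    border j b D (j.succAbove p) j = b (j.succAbove p) := by
  simp [border]

@[simp]
theorem border_succAbove_succAbove (p q : Fin n) :
    border j b D (j.succAbove p) (j.succAbove q) = D p q := by
  simp [border]

@[simp]
theorem border_succ_zero (p : Fin n) : border 0 b D p.succ 0 = b p.succ :=
  border_succAbove_same 0 b D p

@[simp]
theorem border_succ_succ (p q : Fin n) : border 0 b D p.succ q.succ = D p q :=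
  border_succAbove_succAbove 0 b D p q

theorem border_map {S : Type*} (φ : R → S) :
    (border j b D).map φ = border j (φ ∘ b) (D.map φ) := by
  ext1 i l
  induction i using j.succAboveCases with
  | x => simp
  | p i => induction l using j.succAboveCases <;> simp

theorem border_isSymm (hD : D.IsSymm) : (border j b D).IsSymm := by
  refine Matrix.IsSymm.ext fun i l => ?_
  induction i using j.succAboveCases with
  | x => induction l using j.succAboveCases <;> simp
  | p i => induction l using j.succAboveCases <;> simp [hD.apply]

end Border

section Generic

open MvPolynomial

variable (R : Type*) [CommRing R] (n : ℕ)

/-- The generic symmetric `n × n` matrix over `R`. -/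
noncomputable def gen : Matrix (Fin n) (Fin n) (MvPolynomial (Sym2 (Fin n)) R) :=
  Matrix.of fun i j => X s(i, j)

variable {R n}

theorem gen_apply (i j : Fin n) : gen R n i j = X s(i, j) := rfl

theorem map_gen {S : Type*} [CommRing S] (φ : R →+* S) :
    (gen R n).map (MvPolynomial.map φ) = gen S n := by
  ext1 i j
  simp [gen_apply]

/-- The translation of the space of symmetric matrices by a symmetric matrix. -/
noncomputable def translateHom (T : Matrix (Fin n) (Fin n) R) (hT : T.IsSymm) :
    MvPolynomial (Sym2 (Fin n)) R →ₐ[R] MvPolynomial (Sym2 (Fin n)) R :=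
  aeval fun s => X s + C (Sym2.lift ⟨fun i j => T i j, fun i j => hT.apply j i⟩ s)

theorem translateHom_comp {T T' : Matrix (Fin n) (Fin n) R} (hT : T.IsSymm) (hT' : T'.IsSymm)
    (h : T + T' = 0) : (translateHom T hT).comp (translateHom T' hT') = AlgHom.id R _ := by
  ext1 s
  induction s with | _ i j
  have hij : T i j + T' i j = 0 := congrFun (congrFun h i) j
  simp [translateHom, add_assoc, ← C_add, hij]

/-- The translation of the space of symmetric matrices by a symmetric matrix. -/
noncomputable def translate (T : Matrix (Fin n) (Fin n) R) (hT : T.IsSymm) :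
    MvPolynomial (Sym2 (Fin n)) R ≃ₐ[R] MvPolynomial (Sym2 (Fin n)) R :=
  AlgEquiv.ofAlgHom (translateHom T hT) (translateHom (-T) hT.neg)
    (translateHom_comp _ _ (by simp)) (translateHom_comp _ _ (by simp))

theorem gen_map_translate (T : Matrix (Fin n) (Fin n) R) (hT : T.IsSymm) :
    (gen R n).map (translate T hT) = gen R n + T.map C := by
  ext1 i j
  simp [translate, translateHom, gen_apply]

variable (j : Fin (n + 1)) (b : Fin (n + 1) → R) (D : Matrix (Fin n) (Fin n) R)

theorem gen_isSymm : (gen R n).IsSymm := Matrix.IsSymm.ext fun i l => by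
  rw [gen_apply, gen_apply, Sym2.eq_swap]

/-- The entries of a symmetric matrix with row and column `j` separated from the others. -/
noncomputable def borderHom : MvPolynomial (Sym2 (Fin (n + 1))) R →ₐ[R]
    MvPolynomial (Sym2 (Fin n)) (MvPolynomial (Fin (n + 1)) R) :=
  aeval (Sym2.lift ⟨fun i l => border j (fun i => C (X i)) (gen _ n) i l,
    fun i l => (border_isSymm j _ _ gen_isSymm).apply l i⟩)

/-- The inverse of `borderHom`. -/
noncomputable def borderInv : MvPolynomial (Sym2 (Fin n)) (MvPolynomial (Fin (n + 1)) R) →ₐ[R]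
    MvPolynomial (Sym2 (Fin (n + 1))) R :=
  aevalTower (aeval fun i => X s(j, i)) fun s => X (s.map j.succAbove)

theorem borderHom_X (i l : Fin (n + 1)) :
    borderHom (R := R) j (X s(i, l)) = border j (fun i => C (X i)) (gen _ n) i l := by
  simp [borderHom]

/-- The entries of a symmetric matrix with row and column `j` separated from the others. -/
noncomputable def borderEquiv : MvPolynomial (Sym2 (Fin (n + 1))) R ≃ₐ[R]
    MvPolynomial (Sym2 (Fin n)) (MvPolynomial (Fin (n + 1)) R) :=
  AlgEquiv.ofAlgHom (borderHom j) (borderInv j)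
    (by
      refine MvPolynomial.algHom_ext' ?_ ?_
      · ext i
        simp [borderInv, borderHom_X]
      · intro s
        induction s with | _ p q
        simp [borderInv, borderHom_X, gen_apply])
    (by
      ext1 s
      induction s with | _ i l
      rw [AlgHom.comp_apply, borderHom_X]
      induction i using j.succAboveCases with
      | x => simp [borderInv]
      | p i =>
        induction l using j.succAboveCases with
        | x => simp [borderInv, Sym2.eq_swap]
        | p l => simp [borderInv, gen_apply])

theorem gen_map_borderEquiv :
    (gen R (n + 1)).map (borderEquiv j) = border j (fun i => C (X i)) (gen _ n) := by
  ext1 i l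
  exact borderHom_X j i l

end Generic

end KZero

/-! ### Symmetric matrices with a prescribed first row -/

namespace KZero

open MvPolynomial

variable {K : Type u} [Field K] {R S T : Type u} [CommRing R] [CommRing S] [CommRing T]
  [Algebra K R] [Algebra K S] [Algebra K T] [Algebra.FiniteType K R] [Algebra.FiniteType K S]
  [Algebra.FiniteType K T]

theorem acls_quotient_eq {I J : Ideal R} (h : I = J) : acls K (R ⧸ I) = acls K (R ⧸ J) := by
  subst h
  rfl

theorem acls_gen (n : ℕ) (k : ℤ) :
    acls K (MvPolynomial (Sym2 (Fin n)) R ⧸ minors k (gen R n)) = acls K R * symCls K n k := by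
  rw [symCls, ← acls_mvPolynomial_quotient, ← map_gen (algebraMap K R), ← map_minors]
  rfl

/-- If the ranks differ by `k - l` at every field-valued point, the two rank conditions define the
same closed set. -/
theorem acls_minors_congr {ν μ : Type*} [Fintype ν] [Fintype μ] (N : Matrix ν ν R)
    (M : Matrix μ μ R) (k l : ℤ) (h : ∀ (F : Type u) [Field F] (φ : R →+* F),
      ((N.map φ).rank : ℤ) - k = (M.map φ).rank - l) :
    acls K (R ⧸ minors k N) = acls K (R ⧸ minors l M) := by
  refine acls_quotient_congr fun F _ φ => ?_
  rw [minors_le_ker_iff, minors_le_ker_iff]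
  have := h F φ
  omega

theorem acls_minors_map {ν : Type*} (e : R ≃ₐ[K] S) (k : ℤ) (N : Matrix ν ν R) :
    acls K (R ⧸ minors k N) = acls K (S ⧸ minors k (N.map e)) := by
  rw [acls_quotient_map e, map_minors]
  rfl

/-- The elimination step. An invertible pivot `A` contributes its size to the rank, and the rest is
the rank of the Schur complement `gen - Pᵀ A⁻¹ P`. Translating the space of symmetric matrices by
`Pᵀ A⁻¹ P` turns this complement into the generic matrix. -/
theorem acls_minors_fromBlocks {n : ℕ} {ν m : Type*} [Fintype ν] [Fintype m] [DecidableEq m]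
    (N : Matrix ν ν (MvPolynomial (Sym2 (Fin n)) R)) (e : m ⊕ Fin n ≃ ν) (A : Matrix m m R)
    (P : Matrix m (Fin n) R) (hA : A.IsSymm) (hu : IsUnit A.det)
    (hN : N.submatrix e e = Matrix.fromBlocks (A.map C) (P.map C) (P.transpose.map C) (gen R n))
    (k : ℤ) : acls K (MvPolynomial (Sym2 (Fin n)) R ⧸ minors k N) =
      acls K R * symCls K n (k - Fintype.card m) := by
  set T : Matrix (Fin n) (Fin n) R := P.transpose * A⁻¹ * P with hTdef
  have hT : T.IsSymm := by
    rw [hTdef, Matrix.IsSymm, Matrix.transpose_mul, Matrix.transpose_mul,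
      Matrix.transpose_transpose, Matrix.transpose_nonsing_inv, hA.eq, Matrix.mul_assoc]
  rw [← acls_gen, acls_minors_map ((translate T hT).restrictScalars K)]
  refine acls_minors_congr _ _ _ _ fun F _ φ => ?_
  set ψ : R →+* F := φ.comp C with hψ
  let inv : Invertible (A.map ψ) :=
    ⟨A⁻¹.map ψ,
      by rw [← Matrix.map_mul, Matrix.nonsing_inv_mul _ hu,
        Matrix.map_one _ ψ.map_zero ψ.map_one],
      by rw [← Matrix.map_mul, Matrix.mul_nonsing_inv _ hu,
        Matrix.map_one _ ψ.map_zero ψ.map_one]⟩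
  have h1 : (((N.map ((translate T hT).restrictScalars K)).map φ).submatrix e e) =
      Matrix.fromBlocks (A.map ψ) (P.map ψ) (P.transpose.map ψ)
        ((gen R n).map φ + T.map ψ) := by
    change ((N.submatrix e e).map (translate T hT)).map φ = _
    rw [hN, Matrix.fromBlocks_map, Matrix.fromBlocks_map, gen_map_translate]
    have hC : ∀ r : R, translate T hT (C r) = C r := (translate T hT).commutes
    congr 1 <;> ext1 <;> simp [hψ, hC]
  have h2 : ⅟(A.map ψ) = A⁻¹.map ψ := rfl
  rw [← Matrix.rank_submatrix _ e e, h1, Matrix.rank_fromBlocks_of_invertible₁₁, h2, hTdef,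
    Matrix.map_mul, Matrix.map_mul, add_sub_cancel_right]
  push_cast
  ring

theorem acls_minors_fromBlocks_zero {n : ℕ} {ν m : Type*} [Fintype ν] [Fintype m] [DecidableEq m]
    (N : Matrix ν ν (MvPolynomial (Sym2 (Fin n)) R)) (e : m ⊕ Fin n ≃ ν)
    (hN : N.submatrix e e = Matrix.fromBlocks 0 0 0 (gen R n)) (k : ℤ) :
    acls K (MvPolynomial (Sym2 (Fin n)) R ⧸ minors k N) = acls K R * symCls K n k := by
  rw [← acls_gen]
  refine acls_minors_congr _ _ _ _ fun F _ φ => ?_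
  have h1 : (N.map φ).submatrix e e = Matrix.fromBlocks 0 0 0 ((gen R n).map φ) := by
    change (N.submatrix e e).map φ = _
    rw [hN, Matrix.fromBlocks_map]
    congr 1 <;> exact Matrix.map_zero _ φ.map_zero
  rw [← Matrix.rank_submatrix _ e e, h1, Matrix.rank_fromBlocks_zero₁₁]

variable (K) in
/-- The class of the variety of symmetric matrices of rank at most `k` with first row `b`. -/
noncomputable def borderCls {n : ℕ} (b : Fin (n + 1) → R) (k : ℤ) : K0 K :=
  acls K (MvPolynomial (Sym2 (Fin n)) R ⧸ minors k (border 0 (fun i => C (b i)) (gen R n)))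

theorem symCls_succ (n : ℕ) (k : ℤ) :
    symCls K (n + 1) k = borderCls K (X : Fin (n + 1) → MvPolynomial (Fin (n + 1)) K) k := by
  refine (acls_minors_map (borderEquiv 0) k (gen K (n + 1))).trans ?_
  exact acls_quotient_eq (by rw [gen_map_borderEquiv])

/-- The first index and the others. -/
noncomputable def sumFinEquiv₁ (n : ℕ) : Fin 1 ⊕ Fin n ≃ Fin (n + 1) :=
  Equiv.ofBijective (Sum.elim (fun _ => 0) Fin.succ) <| by
    rw [Fintype.bijective_iff_injective_and_card]
    refine ⟨Function.Injective.sumElim (Function.injective_of_subsingleton _)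
      (Fin.succ_injective n) fun _ i => (Fin.succ_ne_zero i).symm, ?_⟩
    simp [add_comm]

/-- The first index, another index, and the remaining ones. -/
noncomputable def sumFinEquiv₂ {n : ℕ} (j : Fin (n + 1)) : Fin 2 ⊕ Fin n ≃ Fin (n + 2) :=
  Equiv.ofBijective (Sum.elim ![0, j.succ] fun p => (j.succAbove p).succ) <| by
    rw [Fintype.bijective_iff_injective_and_card]
    refine ⟨Function.Injective.sumElim ?_ ?_ ?_, by simp [add_comm]⟩
    · intro a b
      fin_cases a <;> fin_cases b <;> simp [Fin.succ_ne_zero, (Fin.succ_ne_zero _).symm]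
    · exact (Fin.succ_injective _).comp Fin.succAbove_right_injective
    · intro a p
      fin_cases a
      · exact (Fin.succ_ne_zero _).symm
      · simp [(Fin.succAbove_ne j p).symm]

theorem borderCls_of_isUnit_zero {n : ℕ} (b : Fin (n + 1) → R) (k : ℤ) (h : IsUnit (b 0)) :
    borderCls K b k = acls K R * symCls K n (k - 1) := by
  refine acls_minors_fromBlocks _ (sumFinEquiv₁ n) (Matrix.of fun _ _ => b 0)
    (Matrix.of fun _ p => b p.succ) rfl (by simpa using h) ?_ k
  ext1 (i | i) (l | l) <;> simp [sumFinEquiv₁]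

/-- The pivot is the block on the first index and `j.succ`. The factor `𝕃 ^ (n + 1)` comes from row
`j` of the lower block, whose entries stay free. -/
theorem borderCls_of_isUnit_succ {n : ℕ} (b : Fin (n + 2) → R) (k : ℤ) (j : Fin (n + 1))
    (h0 : b 0 = 0) (h : IsUnit (b j.succ)) :
    borderCls K b k = acls K R * lefschetz K ^ (n + 1) * symCls K n (k - 2) := by
  -- Row `j` of the lower block is moved into the base ring, so that the pivot has its entries
  -- there.
  rw [borderCls, acls_minors_map ((borderEquiv j).restrictScalars K), ← acls_mvPolynomial_fin]
  have hu : IsUnit (C (b j.succ) : MvPolynomial (Fin (n + 1)) R) := h.map C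
  refine acls_minors_fromBlocks _ (sumFinEquiv₂ j) !![0, C (b j.succ); C (b j.succ), X j]
    (Matrix.of ![fun p => C (b (j.succAbove p).succ), fun p => X (j.succAbove p)]) ?_ ?_ ?_ k
  · refine Matrix.IsSymm.ext fun i l => ?_
    fin_cases i <;> fin_cases l <;> rfl
  · rw [Matrix.det_fin_two_of, zero_mul, zero_sub]
    exact (hu.mul hu).neg
  · have hC : ∀ r : R, borderEquiv j (C r) = C (C r) := (borderEquiv j).commutes
    change ((border 0 (fun i => C (b i)) (gen R (n + 1))).map (borderEquiv j)).submatrix _ _ = _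
    rw [border_map, gen_map_borderEquiv]
    ext1 (i | i) (l | l)
    · fin_cases i <;> fin_cases l <;> simp [sumFinEquiv₂, h0, hC]
    · fin_cases i <;> simp [sumFinEquiv₂, hC]
    · fin_cases l <;> simp [sumFinEquiv₂, hC]
    · simp [sumFinEquiv₂]

theorem borderCls_map {n : ℕ} (e : R ≃ₐ[K] S) (b : Fin (n + 1) → R) (k : ℤ) :
    borderCls K b k = borderCls K (fun i => e (b i)) k := by
  refine (acls_minors_map (mapAlgEquiv (Sym2 (Fin n)) e) k _).trans (acls_quotient_eq ?_)
  rw [border_map]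
  congr 2
  · ext1 i
    simp
  · exact map_gen (e : R →+* S)

theorem borderCls_zero {n : ℕ} (k : ℤ) :
    borderCls K (0 : Fin (n + 1) → R) k = acls K R * symCls K n k := by
  refine acls_minors_fromBlocks_zero _ (sumFinEquiv₁ n) ?_ k
  ext1 (i | i) (l | l) <;> simp [sumFinEquiv₁]

attribute [local instance] MvPolynomial.algebraMvPolynomial in
theorem borderCls_split [Algebra R T] [IsScalarTower K R T] (p : R →ₐ[K] S) (f : R)
    [IsLocalization.Away f T] (hp : Function.Surjective p) (hk : RingHom.ker p = Ideal.span {f})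
    {n : ℕ} (b : Fin (n + 1) → R) (k : ℤ) : borderCls K b k =
      borderCls K (fun i => p (b i)) k + borderCls K (fun i => algebraMap R T (b i)) k := by
  have h1 : IsLocalization.Away (C f : MvPolynomial (Sym2 (Fin n)) R)
      (MvPolynomial (Sym2 (Fin n)) T) := by
    have := MvPolynomial.isLocalization (σ := Sym2 (Fin n)) (Submonoid.powers f) T
    rwa [Submonoid.map_powers] at this
  have h2 : IsScalarTower K (MvPolynomial (Sym2 (Fin n)) R) (MvPolynomial (Sym2 (Fin n)) T) := by
    refine IsScalarTower.of_algebraMap_eq fun x => ?_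
    rw [algebraMap_def, MvPolynomial.algebraMap_apply, MvPolynomial.algebraMap_apply, map_C,
      ← IsScalarTower.algebraMap_apply]
  have h3 : RingHom.ker (mapAlgHom (σ := Sym2 (Fin n)) p) = Ideal.span {C f} := by
    have h := MvPolynomial.ker_map (σ := Sym2 (Fin n)) (p : R →+* S)
    rw [show RingHom.ker (p : R →+* S) = Ideal.span {f} from hk, Ideal.map_span,
      Set.image_singleton] at h
    exact h
  refine (acls_quotient_split (T := MvPolynomial (Sym2 (Fin n)) T)
    (mapAlgHom (σ := Sym2 (Fin n)) p) (C f) (map_surjective _ hp) h3 _).trans ?_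
  congr 1 <;> refine acls_quotient_eq ?_
  · rw [map_minors, border_map]
    congr 2
    · ext1 i
      simp
    · exact map_gen (p : R →+* S)
  · rw [map_minors, border_map]
    congr 2
    · ext1 i
      exact map_C (algebraMap R T) (b i)
    · exact map_gen (algebraMap R T)

end KZero

/-! ### The recursive polynomials and their closed formula -/

namespace KZero

open Polynomial

/-- The polynomials giving the classes of the varieties of symmetric matrices of given size and
rank, defined by eliminating the first row and column. -/
noncomputable def rankPoly : ℕ → ℕ → ℤ[X]
  | 0, 0 => 1
  | 0, _ + 1 => 0
  | _ + 1, 0 => 1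
  | n + 1, 1 => rankPoly n 1 + (X - 1) * X ^ n * rankPoly n 0
  | 0 + 1, k + 2 => rankPoly 0 (k + 2) + (X - 1) * X ^ 0 * rankPoly 0 (k + 1)
  | n + 1 + 1, k + 2 =>
    rankPoly (n + 1) (k + 2) + (X - 1) * X ^ (n + 1) * rankPoly (n + 1) (k + 1) +
      (X ^ (n + 1) - 1) * X ^ (n + 1) * rankPoly n k

/-- The factor at `i = n` is `X ^ 0 - 1`. Thus the closed formula also gives `0` for `k > n`, where
the recursion reaches. -/
theorem prod_range_eq_zero_of_lt (n k : ℕ) (h : n < k) :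
    ∏ i ∈ Finset.range k, (X ^ (n - i) - 1 : ℤ[X]) = 0 :=
  Finset.prod_eq_zero (Finset.mem_range.mpr h) (by simp)

theorem rankPoly_zero_right (n : ℕ) : rankPoly n 0 = 1 := by
  cases n <;> simp [rankPoly]

theorem prod_shift (n k : ℕ) : ∏ i ∈ Finset.range (k + 1), (X ^ (n + 1 - i) - 1 : ℤ[X]) =
    (X ^ (n + 1) - 1) * ∏ i ∈ Finset.range k, (X ^ (n - i) - 1) := by
  rw [Finset.prod_range_succ', mul_comm]
  simp

/-- The closed formula for `rankPoly`, with denominators cleared. -/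
theorem rankPoly_mul (n : ℕ) : ∀ k : ℕ,
    rankPoly n k * ∏ i ∈ Finset.Icc 1 (k / 2), (X ^ (2 * i) - 1) =
      (∏ i ∈ Finset.Icc 1 (k / 2), X ^ (2 * i)) * ∏ i ∈ Finset.range k, (X ^ (n - i) - 1) := by
  induction n using Nat.strong_induction_on with
  | _ n ih =>
    intro k
    match n, k with
    | 0, 0 => simp [rankPoly]
    | 0, k + 1 => rw [prod_range_eq_zero_of_lt 0 _ (by omega)]; simp [rankPoly]
    | n + 1, 0 => simp [rankPoly]
    | n + 1, 1 =>
      have := ih n (by omega) 1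
      simp at this
      simp [rankPoly, this, rankPoly_zero_right]
      ring
    | 0 + 1, k + 2 =>
      rw [prod_range_eq_zero_of_lt _ _ (by omega)]; simp [rankPoly]
    | n + 1 + 1, k + 2 =>
      have h1 := ih (n + 1) (by omega) (k + 2)
      have h2 := ih (n + 1) (by omega) (k + 1)
      have h3 := ih n (by omega) k
      have hd : (k + 2) / 2 = k / 2 + 1 := by omega
      rw [prod_shift, Finset.prod_range_succ, hd, Finset.prod_Icc_succ_top (by omega),
        Finset.prod_Icc_succ_top (by omega)] at h1
      rw [prod_shift] at h2
      rw [prod_shift, prod_shift, hd, Finset.prod_Icc_succ_top (by omega),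
        Finset.prod_Icc_succ_top (by omega), rankPoly]
      set F := ∏ i ∈ Finset.range k, (X ^ (n - i) - 1 : ℤ[X]) with hF
      set C := ∏ i ∈ Finset.Icc 1 (k / 2), (X ^ (2 * i) : ℤ[X])
      set D := ∏ i ∈ Finset.Icc 1 (k / 2), (X ^ (2 * i) - 1 : ℤ[X])
      set y := (X ^ (2 * (k / 2 + 1)) : ℤ[X]) with hy
      -- The parity of `k` decides whether passing from `k` to `k + 1` adds the factor `y - 1` to
      -- the denominator.
      rcases Nat.even_or_odd' k with ⟨a, ha | ha⟩
      · have h4 : (k + 1) / 2 = k / 2 := by omega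
        rw [h4] at h2
        -- For `n < k` the subtraction `n - k` truncates and the exponents need not add up, but then
        -- `F = 0`.
        have h5 : F * (y * X ^ (n - k)) = F * X ^ (n + 2) := by
          rcases Nat.lt_or_ge n k with hlt | hge
          · rw [hF, prod_range_eq_zero_of_lt n k hlt, zero_mul, zero_mul]
          · rw [hy, ← pow_add]
            congr 2
            omega
        linear_combination h1 + (X - 1) * X ^ (n + 1) * (y - 1) * h2 +
          (X ^ (n + 1) - 1) * X ^ (n + 1) * (y - 1) * h3 + C * (X ^ (n + 1) - 1) * h5
      · have h4 : (k + 1) / 2 = k / 2 + 1 := by omega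
        rw [h4, Finset.prod_Icc_succ_top (by omega), Finset.prod_Icc_succ_top (by omega)] at h2
        have h5 : F * (y * X ^ (n - k)) = F * X ^ (n + 1) := by
          rcases Nat.lt_or_ge n k with hlt | hge
          · rw [hF, prod_range_eq_zero_of_lt n k hlt, zero_mul, zero_mul]
          · rw [hy, ← pow_add]
            congr 2
            omega
        linear_combination h1 + (X - 1) * X ^ (n + 1) * h2 +
          (X ^ (n + 1) - 1) * X ^ (n + 1) * (y - 1) * h3 + C * (X ^ (n + 1) - 1) * h5

/-- The closed formula for `rankPoly` as an identity of rational functions. -/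
theorem algebraMap_rankPoly (n k : ℕ) :
    algebraMap ℤ[X] (FractionRing ℤ[X]) (rankPoly n k) =
      (∏ i ∈ Finset.Icc 1 (k / 2), algebraMap ℤ[X] (FractionRing ℤ[X]) (X ^ (2 * i)) /
        algebraMap ℤ[X] (FractionRing ℤ[X]) (X ^ (2 * i) - 1)) *
      ∏ i ∈ Finset.range k, algebraMap ℤ[X] (FractionRing ℤ[X]) (X ^ (n - i) - 1) := by
  have hne : ∏ i ∈ Finset.Icc 1 (k / 2), algebraMap ℤ[X] (FractionRing ℤ[X]) (X ^ (2 * i) - 1)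
      ≠ 0 := by
    refine Finset.prod_ne_zero_iff.mpr fun i hi => ?_
    rw [Finset.mem_Icc] at hi
    rw [Ne, FaithfulSMul.algebraMap_eq_zero_iff]
    exact X_pow_sub_C_ne_zero (by omega) (1 : ℤ)
  rw [Finset.prod_div_distrib, div_mul_eq_mul_div, eq_div_iff hne, ← map_prod, ← map_prod,
    ← map_prod, ← map_mul, ← map_mul, rankPoly_mul]

end KZero

/-! ### Stratification by the first row and the recursion -/

namespace KZero

open MvPolynomial

variable {K : Type u} [Field K]

variable (K) in
/-- The variable of index `t` of a polynomial ring in `m` variables, or zero if `t ≥ m`. -/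
noncomputable def varOrZero (m t : ℕ) : MvPolynomial (Fin m) K :=
  if h : t < m then X ⟨t, h⟩ else 0

theorem varOrZero_of_lt {m t : ℕ} (h : t < m) : varOrZero K m t = X ⟨t, h⟩ := dif_pos h

theorem varOrZero_of_le {m t : ℕ} (h : m ≤ t) : varOrZero K m t = 0 := dif_neg h.not_gt

variable (K) in
/-- The homomorphism that sends the last variable to zero. -/
noncomputable def killLast (m : ℕ) : MvPolynomial (Fin (m + 1)) K →ₐ[K] MvPolynomial (Fin m) K :=
  aeval fun t => varOrZero K m t

theorem killLast_varOrZero (m t : ℕ) : killLast K m (varOrZero K (m + 1) t) = varOrZero K m t := by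
  rcases Nat.lt_or_ge t (m + 1) with h | h
  · simp [varOrZero_of_lt h, killLast]
  · rw [varOrZero_of_le h, varOrZero_of_le (by omega), map_zero]

theorem killLast_rename (m : ℕ) (x : MvPolynomial (Fin m) K) :
    killLast K m (rename Fin.castSucc x) = x := by
  have h : (killLast K m).comp (rename Fin.castSucc) = AlgHom.id K _ := by
    ext1 t
    simp [killLast, varOrZero_of_lt t.2]
  exact DFunLike.congr_fun h x

theorem killLast_surjective (m : ℕ) : Function.Surjective (killLast K m) :=
  fun x => ⟨_, killLast_rename m x⟩

theorem ker_killLast (m : ℕ) : RingHom.ker (killLast K m) = Ideal.span {X (Fin.last m)} := by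
  refine le_antisymm (fun x hx => ?_) ?_
  · have h : ((Ideal.Quotient.mkₐ K (Ideal.span {X (Fin.last m)})).comp
        (rename Fin.castSucc)).comp (killLast K m) = Ideal.Quotient.mkₐ K _ := by
      ext1 t
      induction t using Fin.lastCases with
      | last =>
        have h0 : Ideal.Quotient.mk (Ideal.span {(X (Fin.last m) : MvPolynomial _ K)})
          (X (Fin.last m)) = 0 :=
          Ideal.Quotient.eq_zero_iff_mem.mpr (Ideal.mem_span_singleton_self _)
        simp [killLast, varOrZero_of_le, h0]
      | cast t => simp [killLast, varOrZero_of_lt t.2]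
    have hx' := DFunLike.congr_fun h x
    rw [AlgHom.comp_apply, (RingHom.mem_ker).mp hx, map_zero] at hx'
    exact Ideal.Quotient.eq_zero_iff_mem.mp hx'.symm
  · rw [Ideal.span_singleton_le_iff_mem, RingHom.mem_ker]
    simp [killLast, varOrZero_of_le]

variable (K) in
/-- The coordinate ring of the open subset of affine space where the last coordinate is
nonzero. -/
abbrev LastAway (m : ℕ) : Type u :=
  Localization.Away (X (Fin.last m) : MvPolynomial (Fin (m + 1)) K)

theorem acls_lastAway (m : ℕ) :
    acls K (LastAway K m) = lefschetz K ^ (m + 1) - lefschetz K ^ m := by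
  have h := acls_split (T := LastAway K m) (killLast K m) (X (Fin.last m)) (killLast_surjective m)
    (by rw [ker_killLast])
  rw [acls_mvPolynomial_fin, acls_mvPolynomial_fin, acls_self, one_mul, one_mul] at h
  rw [h, add_sub_cancel_left]

theorem borderCls_varOrZero_succ (n m : ℕ) (k : ℤ) :
    borderCls K (fun i : Fin (n + 1) => varOrZero K (m + 1) (n - i)) k =
      borderCls K (fun i : Fin (n + 1) => varOrZero K m (n - i)) k +
      borderCls K (fun i : Fin (n + 1) =>
        algebraMap _ (LastAway K m) (varOrZero K (m + 1) (n - i))) k := by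
  rw [borderCls_split (T := LastAway K m) (killLast K m) (X (Fin.last m)) (killLast_surjective m)
    (ker_killLast m)]
  simp only [killLast_varOrZero]

theorem isUnit_algebraMap_varOrZero (m : ℕ) :
    IsUnit (algebraMap _ (LastAway K m) (varOrZero K (m + 1) m)) := by
  rw [varOrZero_of_lt (Nat.lt_succ_self m)]
  exact IsLocalization.Away.algebraMap_isUnit (X (Fin.last m))

/-- Entry `i` of the row is the variable of index `n - i`, so only the last `m` entries are nonzero.
Each induction step separates the locus where the first of them is invertible, with class `𝕃 ^ (m +
1) - 𝕃 ^ m`; these telescope to `𝕃 ^ m - 1`. For `n = 0` this factor vanishes, so the truncated `n -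
1` is harmless. -/
theorem borderCls_varOrZero (n m : ℕ) (k : ℤ) (h : m ≤ n) :
    borderCls K (fun i : Fin (n + 1) => varOrZero K m (n - i)) k =
      symCls K n k + (lefschetz K ^ m - 1) * lefschetz K ^ n * symCls K (n - 1) (k - 2) := by
  induction m with
  | zero =>
    have h0 : (fun i : Fin (n + 1) => varOrZero K 0 (n - i)) = 0 :=
      funext fun i => varOrZero_of_le (Nat.zero_le _)
    rw [h0, borderCls_zero, acls_mvPolynomial_fin, acls_self]
    simp
  | succ m ih =>
    obtain ⟨n, rfl⟩ : ∃ n', n = n' + 1 := ⟨n - 1, by omega⟩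
    rw [borderCls_varOrZero_succ, ih (by omega),
      -- In a row of length `n + 2`, the variable of index `m` sits at position `n + 1 - m`, the
      -- successor of `n - m`.
      borderCls_of_isUnit_succ _ k ⟨n - m, by omega⟩, acls_lastAway]
    · simp only [Nat.add_sub_cancel]
      ring
    · rw [varOrZero_of_le (by simpa using h), map_zero]
    · have h1 : n + 1 - (n - m + 1) = m := by omega
      simp only [Fin.succ_mk, h1]
      exact isUnit_algebraMap_varOrZero m

/-- The recursion given by eliminating the first row and column of a symmetric matrix. -/
theorem symCls_succ_eq (n : ℕ) (k : ℤ) : symCls K (n + 1) k = symCls K n k +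
    (lefschetz K - 1) * lefschetz K ^ n * symCls K n (k - 1) +
    (lefschetz K ^ n - 1) * lefschetz K ^ n * symCls K (n - 1) (k - 2) := by
  -- The variables are reversed so that killing the last one kills the first entry of the row.
  have h0 : (fun i : Fin (n + 1) => renameEquiv K Fin.revPerm (X i)) =
      fun i : Fin (n + 1) => varOrZero K (n + 1) (n - i) := by
    ext1 i
    rw [varOrZero_of_lt (by omega), renameEquiv_apply, rename_X]
    congr 1
    ext
    simp [Fin.val_rev]
  rw [symCls_succ, borderCls_map (renameEquiv K Fin.revPerm), h0, borderCls_varOrZero_succ,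
    borderCls_varOrZero n n k le_rfl, borderCls_of_isUnit_zero _ k, acls_lastAway]
  · ring
  · exact isUnit_algebraMap_varOrZero n

theorem minorIdeal_of_neg (n : ℕ) {k : ℤ} (hk : k < 0) : minorIdeal K n k = ⊤ := by
  rw [Ideal.eq_top_iff_one]
  exact Ideal.subset_span ⟨0, Fin.elim0, Fin.elim0, by simpa using hk, by simp⟩

theorem minorIdeal_of_le (n : ℕ) {k : ℤ} (hk : n ≤ k) : minorIdeal K n k = ⊥ := by
  rw [minorIdeal, Ideal.span_eq_bot]
  rintro _ ⟨r, f, g, hr, rfl⟩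
  have hlt : n < r := by omega
  obtain ⟨i, j, hij, he⟩ := Fintype.exists_ne_map_eq_of_card_lt f (by simpa using hlt)
  exact Matrix.det_zero_of_row_eq hij (by ext l; simp [he])

theorem symCls_of_neg (n : ℕ) {k : ℤ} (hk : k < 0) : symCls K n k = 0 := by
  have : Subsingleton (SymRing K n ⧸ minorIdeal K n k) :=
    Ideal.Quotient.subsingleton_iff.mpr (minorIdeal_of_neg n hk)
  exact acls_of_subsingleton

theorem symCls_of_le (n : ℕ) {k : ℤ} (hk : n ≤ k) : symCls K n k = symCls K n n :=
  acls_quotient_eq (by rw [minorIdeal_of_le n hk, minorIdeal_of_le n le_rfl])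

theorem symCls_zero (n : ℕ) : symCls K n 0 = 1 := by
  induction n with
  | zero =>
    rw [← acls_self]
    exact acls_congr (((Ideal.quotientEquivAlgOfEq K (minorIdeal_of_le 0 le_rfl)).trans
      (AlgEquiv.quotientBot K _)).trans (isEmptyAlgEquiv K _))
  | succ n ih =>
    rw [symCls_succ_eq, ih, symCls_of_neg n (by omega), symCls_of_neg (n - 1) (by omega)]
    simp

theorem cls_symVar_of_neg (n : ℕ) {k : ℤ} (hk : k < 0) : cls (symVar K n k) = 0 := by
  rw [cls_symVar, symCls_of_neg n hk, symCls_of_neg n (by omega), sub_zero]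

theorem cls_symVar_of_lt (n : ℕ) {k : ℤ} (hk : n < k) : cls (symVar K n k) = 0 := by
  rw [cls_symVar, symCls_of_le n hk.le, symCls_of_le n (by omega : (n : ℤ) ≤ k - 1),
    sub_self]

theorem cls_symVar_zero (n : ℕ) : cls (symVar K n 0) = 1 := by
  rw [cls_symVar, symCls_zero, symCls_of_neg n (by omega), sub_zero]

theorem cls_symVar_succ (n : ℕ) (k : ℤ) : cls (symVar K (n + 1) k) = cls (symVar K n k) +
    (lefschetz K - 1) * lefschetz K ^ n * cls (symVar K n (k - 1)) +
    (lefschetz K ^ n - 1) * lefschetz K ^ n * cls (symVar K (n - 1) (k - 2)) := by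
  have h : k - 2 - 1 = k - 1 - 2 := by ring
  simp only [cls_symVar, symCls_succ_eq, h]
  ring

/-- Both sides satisfy the same recursion; terms of negative rank vanish, and for size `1` the last
term carries the factor `𝕃 ^ 0 - 1 = 0`. -/
theorem cls_symVar_eq_aeval (n : ℕ) : ∀ k : ℕ,
    cls (symVar K n k) = Polynomial.aeval (lefschetz K) (rankPoly n k) := by
  induction n using Nat.strong_induction_on with
  | _ n ih =>
    intro k
    match n, k with
    | 0, 0 => simpa [rankPoly] using cls_symVar_zero 0
    | 0, k + 1 => simpa [rankPoly] using cls_symVar_of_lt (K := K) 0 (k := k + 1) (by omega)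
    | n + 1, 0 => simpa [rankPoly] using cls_symVar_zero (n + 1)
    | n + 1, 1 =>
      have h0 := ih n (by omega) 0
      have h1 := ih n (by omega) 1
      push_cast at h0 h1 ⊢
      rw [cls_symVar_succ, sub_self, h0, h1, cls_symVar_of_neg (n - 1) (by omega)]
      simp [rankPoly]
    | 0 + 1, k + 2 =>
      have h0 := ih 0 (by omega) (k + 2)
      have h1 := ih 0 (by omega) (k + 1)
      have e : ((k + 2 : ℕ) : ℤ) - 1 = (k + 1 : ℕ) := by push_cast; ring
      rw [cls_symVar_succ, e, h0, h1]
      simp [rankPoly]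
    | n + 1 + 1, k + 2 =>
      have h0 := ih (n + 1) (by omega) (k + 2)
      have h1 := ih (n + 1) (by omega) (k + 1)
      have h2 := ih n (by omega) k
      have e : ((k + 2 : ℕ) : ℤ) - 1 = (k + 1 : ℕ) := by push_cast; ring
      have e' : ((k + 2 : ℕ) : ℤ) - 2 = (k : ℕ) := by push_cast; ring
      rw [cls_symVar_succ, e, e', h0, h1, Nat.add_sub_cancel, h2]
      simp [rankPoly]

end KZero

theorem theorem2 (K : Type u) [Field K] (hK : ringChar K ≠ 2) (n : ℕ) :
    (∀ k : ℤ, (k < 0 ∨ (n : ℤ) < k) → KZero.cls (KZero.symVar K n k) = 0) ∧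
    KZero.cls (KZero.symVar K n 0) = 1 ∧
    ∀ k : ℕ, 0 < k → k ≤ n →
      ∃ P : Polynomial ℤ,
        (algebraMap (Polynomial ℤ) (FractionRing (Polynomial ℤ)) P =
          (∏ i ∈ Finset.Icc 1 (k / 2),
            algebraMap (Polynomial ℤ) (FractionRing (Polynomial ℤ)) (Polynomial.X ^ (2 * i)) /
            algebraMap (Polynomial ℤ) (FractionRing (Polynomial ℤ))
              (Polynomial.X ^ (2 * i) - 1)) *
          ∏ i ∈ Finset.range k,
            algebraMap (Polynomial ℤ) (FractionRing (Polynomial ℤ))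
              (Polynomial.X ^ (n - i) - 1)) ∧
        KZero.cls (KZero.symVar K n (k : ℤ)) = Polynomial.aeval (KZero.lefschetz K) P := by
  refine ⟨fun k hk => hk.elim (KZero.cls_symVar_of_neg n) (KZero.cls_symVar_of_lt n),
    KZero.cls_symVar_zero n, fun k _ _ =>
      ⟨KZero.rankPoly n k, KZero.algebraMap_rankPoly n k, KZero.cls_symVar_eq_aeval n k⟩⟩
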